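/- Let $q$ be a prime power, let $k,m\ge 1$ be integers with $(k-1)m$ even, and let $V$ be a $k$-dimensional vector space over $\mathbb{F}_{q^m}$. For an $\mathbb{F}_q$-subspace $U$ of $V$, the linear set $L_U=\{\langle u\rangle_{\mathbb{F}_{q^m}} : u\in U\setminus\{0\}\}\subseteq \mathrm{PG}(V,\mathbb{F}_{q^m})=\mathrm{PG}(k-1,q^m)$ has rank $\dim_{\mathbb{F}_q}U$, and the weight of a point $P=\langle v\rangle_{\mathbb{F}_{q^m}}$ in $L_U$ is $\dim_{\mathbb{F}_q}(U\cap\langle v\rangle_{\mathbb{F}_{q^m}})$. The set $L_U$ is scattered if all its points have weight one; it is maximum scattered in $\mathrm{PG}(W,\mathbb{F}_{q^m})$, where $W$ is an $r$-dimensional $\mathbb{F}_{q^m}$-subspace of $V$, if moreover $U\subseteq W$ and $\dim_{\mathbb{F}_q}U=rm/2$; it is an $i$-club if one of its points has weight $i$ and all its other points have weight one. (1) (Cone construction) Let $H=\mathrm{PG}(W,\mathbb{F}_{q^m})$ be a hyperplane of $\mathrm{PG}(k-1,q^m)$, let $L_{U'}$ be a maximum scattered $\mathbb{F}_q$-linear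 set in $H$, let $x\in V\setminus\{0\}$ with $\langle x\rangle_{\mathbb{F}_{q^m}}\cap W=\{0\}$, and let $U''$ be an $i$-dimensional $\mathbb{F}_q$-subspace of $\langle x\rangle_{\mathbb{F}_{q^m}}$, where $i\ge m/2$. Put $U=U'+U''$. Then $L_U$ is an $i$-club of rank $\frac{(k-1)m}{2}+i$. (2) For every integer $i$ with $m/2\le i\le m$ there is an $i$-club in $\mathrm{PG}(k-1,q^m)$ whose rank is the largest among all $i$-clubs of $\mathrm{PG}(k-1,q^m)$. If $m\ge 2$, and if $k\neq 2$ or $i=m/2$, this largest rank is $\frac{(k-1)m}{2}+i$. If $k=2$ and $i=m$, it is $m+1$. -/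

import Mathlib

open scoped LinearAlgebra.Projectivization

/-!
Throughout, `F` plays the role of `𝔽_q`, `L` that of its degree-`m` extension `𝔽_{q^m}`, and `V` is
a `k`-dimensional `L`-space, so that the points of `PG(k-1, q^m)` are the elements of `ℙ L V`.
The rank of the linear set of an `F`-subspace `U` of `V` is `Module.finrank F U`.
-/

section LinearSets

variable {F L V : Type*} [Field F] [Field L] [Algebra F L]
  [AddCommGroup V] [Module F V] [Module L V] [IsScalarTower F L V]

/-- The `F`-linear set `L_U = {⟨u⟩_L : u ∈ U, u ≠ 0}` of an `F`-subspace `U` of `V`. -/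
def linearSet (L : Type*) [Field L] [Module L V] (U : Submodule F V) : Set (ℙ L V) :=
  {P | ∃ (u : V) (hu : u ≠ 0), u ∈ U ∧ P = Projectivization.mk L u hu}

/-- The weight `dim_F (U ∩ W)` of the projective subspace `PG(W)` in `L_U`. -/
noncomputable def linearSetWeight (U : Submodule F V) (W : Submodule L V) : ℕ :=
  Module.finrank F (U ⊓ W.restrictScalars F : Submodule F V)

/-- `L_U` is scattered: all of its points have weight one. -/
def IsScatteredLinearSet (L : Type*) [Field L] [Algebra F L] [Module L V] [IsScalarTower F L V]
    (U : Submodule F V) : Prop :=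
  ∀ P ∈ linearSet L U, linearSetWeight U P.submodule = 1

/-- `L_U` is a maximum scattered linear set in the projective subspace `PG(W)`: it is contained
in `PG(W)`, it is scattered, and its rank is `r * m / 2`, where `r = dim_L W`, `m = [L : F]`. -/
def IsMaximumScatteredIn (W : Submodule L V) (U : Submodule F V) : Prop :=
  U ≤ W.restrictScalars F ∧ IsScatteredLinearSet L U ∧
    2 * Module.finrank F U = Module.finrank L W * Module.finrank F L

/-- `L_U` is an `i`-club: one of its points has weight `i`, all the others have weight one. -/
def IsClubLinearSet (L : Type*) [Field L] [Algebra F L] [Module L V] [IsScalarTower F L V]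
    (i : ℕ) (U : Submodule F V) : Prop :=
  ∃ P ∈ linearSet L U, linearSetWeight U P.submodule = i ∧
    ∀ Q ∈ linearSet L U, Q ≠ P → linearSetWeight U Q.submodule = 1

/-- `L_U` is an `i`-club of the largest rank among all `i`-clubs of `PG(V)`. -/
def IsMaximumRankClub (L : Type*) [Field L] [Algebra F L] [Module L V] [IsScalarTower F L V]
    (i : ℕ) (U : Submodule F V) : Prop :=
  IsClubLinearSet L i U ∧
    ∀ U₁ : Submodule F V, IsClubLinearSet L i U₁ → Module.finrank F U₁ ≤ Module.finrank F U

end LinearSets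

/-! Write `q = |F|` and `m = [L : F]`. For the cone, `⟨x⟩ ∩ W = 0` makes the sum direct: a vector of
`U' + U''` off `⟨x⟩` has a nonzero component in the scattered `U'`, which already forces its weight
to be one.

For the upper bound, let `⟨v⟩` be the point of weight `i` and `A = {c : c v ∈ U}`. Since `2i ≥ m`, a
count of linear functionals yields `α ∉ F` with `A + αA = L`. Outside `⟨v⟩` no nonzero `u` has both
`u` and `αu` in `U`, so `U ∩ αU ⊆ (A ∩ αA)v` has dimension at most `2i - m`. Then `2 dim U ≤ km + 2i
- m` (`IsClubLinearSet.two_mul_finrank_le`).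

For sharpness with `k ≠ 2`, cones suffice once maximum scattered sets exist in dimension `r = k - 1
≠ 1` (`hasMaximumScattered`). These are direct sums of Frobenius graphs in `L × L` and, for odd `r`,
one three-dimensional block. With `E` the subfield of index 2 in `L` and `w ∈ L \ E`, the block is
`{g x + w x : x ∈ E³}`, where `g` is a semilinear map without proper nonzero invariant subspaces
whose companion automorphism fixes exactly `F`. The case `k = 2` needs separate constructions for `i
= m/2` and `i = m`. -/

/-! ### Irreducible semilinear maps in dimension three -/

theorem iterate_mul_pow {M : Type*} [CommMonoid M] (c : M) (Q n : ℕ) (x : M) :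
    (fun y => c * y ^ Q)^[n] x = c ^ (∑ j ∈ Finset.range n, Q ^ j) * x ^ Q ^ n := by
  induction n with
  | zero => simp
  | succ n ih =>
    rw [Function.iterate_succ_apply', ih, Finset.sum_range_succ', mul_pow, ← pow_mul, ← pow_mul,
      Finset.sum_mul, pow_add, pow_succ Q n]
    simp only [pow_succ, pow_zero, pow_one]
    rw [← mul_assoc, mul_comm c]

theorem pow_card_eq_of_coprime_periods {M : Type*} [Monoid M] {q s t : ℕ} (hst : Nat.Coprime s t)
    {x : M} (hs : x ^ q ^ s = x) (ht : x ^ q ^ t = x) : x ^ q = x := by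
  have h1 : Function.IsPeriodicPt (fun y : M => y ^ q) s x := by
    simpa [Function.IsPeriodicPt, Function.IsFixedPt, pow_iterate] using hs
  have h2 : Function.IsPeriodicPt (fun y : M => y ^ q) t x := by
    simpa [Function.IsPeriodicPt, Function.IsFixedPt, pow_iterate] using ht
  have := h1.gcd h2
  rw [hst.gcd_eq_one] at this
  simpa [Function.IsPeriodicPt, Function.IsFixedPt] using this

/-- The exponent `s = (q^(3n) - 1)/(q^3 - 1)` is that of the norm to the field of order `q^3`. For
`c` a generator of the cyclic group `Kˣ`, the power `c^s` has order `q^3 - 1`, which does not divide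
`q - 1`. -/
theorem exists_norm_power_not_fixed {K : Type*} [Field K] [Finite K] {q n : ℕ} (hq : 2 ≤ q)
    (hn : n ≠ 0) (hK : Nat.card K = (q ^ 3) ^ n) :
    ∃ c : K, c ≠ 0 ∧
      (c ^ (∑ j ∈ Finset.range n, (q ^ 3) ^ j)) ^ q ^ 3 = c ^ (∑ j ∈ Finset.range n, (q ^ 3) ^ j) ∧
      (c ^ (∑ j ∈ Finset.range n, (q ^ 3) ^ j)) ^ q ≠ c ^ (∑ j ∈ Finset.range n, (q ^ 3) ^ j) := by
  classical
  have := Fintype.ofFinite K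
  obtain ⟨u, hu⟩ := IsCyclic.exists_generator (α := Kˣ)
  have hord : orderOf u = Nat.card K - 1 := by
    rw [orderOf_eq_card_of_forall_mem_zpowers hu, Nat.card_units]
  set s := ∑ j ∈ Finset.range n, (q ^ 3) ^ j with hs
  have hQ : q < q ^ 3 := by nlinarith [pow_succ q 2, sq_nonneg q]
  have hgeom : s * (q ^ 3 - 1) = Nat.card K - 1 := by
    rw [hK, hs]
    have := Nat.geomSum_eq (m := q ^ 3) (by omega) n
    rw [this]
    exact Nat.div_mul_cancel (by simpa using Nat.sub_dvd_pow_sub_pow (q ^ 3) 1 n)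
  have hspos : 0 < s := by
    rw [hs]
    exact Finset.sum_pos (fun i _ => by positivity) (by simpa using hn)
  refine ⟨u, u.ne_zero, ?_, ?_⟩
  · have h1 : u ^ (s * (q ^ 3 - 1)) = 1 := by rw [hgeom, ← hord, pow_orderOf_eq_one]
    have h2 : (u ^ s) ^ q ^ 3 = u ^ s := by
      conv_lhs => rw [show q ^ 3 = (q ^ 3 - 1) + 1 by omega, pow_succ, ← pow_mul, h1, one_mul]
    exact_mod_cast congrArg Units.val h2
  · intro h
    have h2 : (u ^ s) ^ q = u ^ s := by
      apply Units.ext; exact_mod_cast h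
    have h3 : u ^ (s * (q - 1)) = 1 := by
      have : (u ^ s) ^ (q - 1) * u ^ s = 1 * u ^ s := by
        rw [← pow_succ, show q - 1 + 1 = q by omega, h2, one_mul]
      rw [pow_mul]; exact mul_right_cancel this
    have h4 := orderOf_dvd_of_pow_eq_one h3
    rw [hord, ← hgeom] at h4
    have h5 := Nat.le_of_dvd (Nat.mul_pos hspos (by omega)) h4
    have h6 := Nat.le_of_mul_le_mul_left h5 hspos
    omega

theorem mem_range_algebraMap_iff_pow_card {F K : Type*} [Field F] [Field K] [Algebra F K] [Finite F]
    [Finite K] (x : K) : x ∈ Set.range (algebraMap F K) ↔ x ^ Nat.card F = x := by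
  have := Fintype.ofFinite F
  constructor
  · rintro ⟨a, rfl⟩
    rw [← map_pow, Nat.card_eq_fintype_card, FiniteField.pow_card]
  · intro h
    rw [IsGalois.mem_range_algebraMap_iff_fixed]
    intro f
    obtain ⟨⟨n, hn⟩, rfl⟩ := (FiniteField.bijective_frobeniusAlgEquivOfAlgebraic_pow F K).2 f
    rw [Nat.card_eq_fintype_card] at h
    rw [AlgEquiv.coe_pow, FiniteField.coe_frobeniusAlgEquivOfAlgebraic]
    exact Function.iterate_fixed h n

theorem frobeniusAlgHom_pow_apply {F K : Type*} [Field F] [Fintype F] [Field K] [Algebra F K]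
    (n : ℕ) (x : K) : (FiniteField.frobeniusAlgHom F K ^ n) x = x ^ Nat.card F ^ n := by
  rw [AlgHom.coe_pow, FiniteField.coe_frobeniusAlgHom, pow_iterate, Nat.card_eq_fintype_card]

/-- The `σ`-semilinear map `g` leaves no subspace invariant except `⊥` and `⊤`. -/
def IsIrreducibleSemilinear {E M : Type*} [Field E] [AddCommGroup M] [Module E M] {σ : E →+* E}
    (g : M →ₛₗ[σ] M) : Prop :=
  ∀ S : Submodule E M, S ≠ ⊥ → (∀ x ∈ S, g x ∈ S) → S = ⊤

theorem iterate_mem_of_invariant {E M : Type*} [Field E] [AddCommGroup M] [Module E M]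
    {σ : E →+* E} (g : M →ₛₗ[σ] M) {S : Submodule E M} (hS : ∀ x ∈ S, g x ∈ S) (n : ℕ) {x : M}
    (hx : x ∈ S) : g^[n] x ∈ S := by
  induction n with
  | zero => exact hx
  | succ n ih => rw [Function.iterate_succ_apply']; exact hS _ ih

/-- The cyclic semilinear map `(x₀, x₁, x₂) ↦ (a σ(x₂), σ(x₀), σ(x₁))`. -/
def cyclicSemilinear {E : Type*} [Field E] (σ : E →+* E) (a : E) :
    (Fin 3 → E) →ₛₗ[σ] (Fin 3 → E) where
  toFun x := ![a * σ (x 2), σ (x 0), σ (x 1)]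
  map_add' x y := by
    ext i; fin_cases i <;> simp [mul_add]
  map_smul' c x := by
    ext i; fin_cases i <;> simp [mul_left_comm]

/-- If `x ∈ S` has `x i ≠ 0`, applying `(d - d j)(d - d k)` kills the other two coordinates, so `S`
contains a basis vector; the cyclic shift then gives all three. -/
theorem eq_top_of_invariant_diagonal {E : Type*} [Field E] {d : Fin 3 → E}
    (hd : Function.Injective d) {S : Submodule E (Fin 3 → E)} (hS : S ≠ ⊥)
    (hD : ∀ x ∈ S, d * x ∈ S) (hc : ∀ i, Pi.single i (1 : E) ∈ S → Pi.single (i + 1) (1 : E) ∈ S) :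
    S = ⊤ := by
  obtain ⟨x, hx, hx0⟩ := S.ne_bot_iff.1 hS
  obtain ⟨i, hi⟩ := Function.ne_iff.1 hx0
  have key : ∀ j k : Fin 3, (∀ l, l ≠ i → l = j ∨ l = k) → i ≠ j → i ≠ k →
      Pi.single i (1 : E) ∈ S := by
    intro j k hjk hij hik
    have h1 : ∀ y ∈ S, ∀ j, d * y - d j • y ∈ S := fun y hy j =>
      S.sub_mem (hD y hy) (S.smul_mem _ hy)
    have h2 := h1 _ (h1 x hx j) k
    have hne : (d i - d k) * (d i - d j) * x i ≠ 0 :=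
      mul_ne_zero (mul_ne_zero (sub_ne_zero.2 (hd.ne hik)) (sub_ne_zero.2 (hd.ne hij))) hi
    convert S.smul_mem ((d i - d k) * (d i - d j) * x i)⁻¹ h2 using 1
    ext l
    simp only [Pi.smul_apply, Pi.sub_apply, Pi.mul_apply, smul_eq_mul]
    by_cases hl : l = i
    · subst hl
      rw [Pi.single_eq_same]
      have e : d l * (d l * x l - d j * x l) - d k * (d l * x l - d j * x l) =
        (d l - d k) * (d l - d j) * x l := by ring
      rw [e, inv_mul_cancel₀ hne]
    · rw [Pi.single_eq_of_ne hl]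
      rcases hjk l hl with rfl | rfl <;> ring
  have hi' : Pi.single i (1 : E) ∈ S :=
    key (i + 1) (i + 2) (by clear key hi; revert i; decide) (by clear key hi; revert i; decide)
      (by clear key hi; revert i; decide)
  have hall : ∀ l, Pi.single l (1 : E) ∈ S := by
    have h3 := hc _ hi'
    have h4 := hc _ h3
    intro l
    have : l = i ∨ l = i + 1 ∨ l = i + 1 + 1 := by
      clear hi hi' h3 h4 key; revert i l; decide
    rcases this with rfl | rfl | rfl <;> assumption
  rw [eq_top_iff, ← (Pi.basisFun E (Fin 3)).span_eq, Submodule.span_le]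
  rintro _ ⟨l, rfl⟩
  simpa using hall l

/-- The iterate `g^(3n)` is the linear map `diag(γ, γ^q, γ^(q²))`, with `γ` the norm power of `a`.
As `γ` is fixed by the `q^3`-power but not by the `q`-power, these entries are distinct. -/
theorem isIrreducibleSemilinear_cyclicSemilinear {E : Type*} [Field E] {q n : ℕ} (σ : E →+* E)
    (hσ : ∀ x, σ x = x ^ q) (hE : ∀ x : E, x ^ (q ^ 3) ^ n = x) {a : E} (ha : a ≠ 0)
    (h3 : (a ^ (∑ j ∈ Finset.range n, (q ^ 3) ^ j)) ^ q ^ 3 =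
      a ^ (∑ j ∈ Finset.range n, (q ^ 3) ^ j))
    (h1 : (a ^ (∑ j ∈ Finset.range n, (q ^ 3) ^ j)) ^ q ≠
      a ^ (∑ j ∈ Finset.range n, (q ^ 3) ^ j)) :
    IsIrreducibleSemilinear (cyclicSemilinear σ a) := by
  intro S hS hinv
  set g := cyclicSemilinear σ a with hg
  set γ := a ^ (∑ j ∈ Finset.range n, (q ^ 3) ^ j) with hγ
  have hg3 : ∀ x : Fin 3 → E, g (g (g x)) = fun i : Fin 3 => a ^ q ^ (i : ℕ) * x i ^ q ^ 3 := by
    intro x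
    ext i
    fin_cases i <;> simp [hg, cyclicSemilinear, hσ, mul_pow, -mul_eq_mul_left_iff] <;> ring
  have hgn : ∀ (k : ℕ) (x : Fin 3 → E),
      g^[3 * k] x = fun i : Fin 3 => (fun y => a ^ q ^ (i : ℕ) * y ^ q ^ 3)^[k] (x i) := by
    intro k
    induction k with
    | zero => intro x; simp
    | succ k ih =>
      intro x
      rw [show 3 * (k + 1) = 3 * k + 1 + 1 + 1 by ring, Function.iterate_succ_apply,
        Function.iterate_succ_apply, Function.iterate_succ_apply, hg3, ih]
      rfl
  refine eq_top_of_invariant_diagonal (d := fun i => γ ^ q ^ (i : ℕ)) ?_ hS ?_ ?_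
  · have hinj := σ.injective
    have e01 : γ ^ q ≠ γ := h1
    have e12 : (γ ^ q) ^ q ≠ γ ^ q := fun h => h1 (hinj (by rw [hσ, hσ]; exact h))
    have e02 : (γ ^ q) ^ q ≠ γ := fun h => by
      have : ((γ ^ q) ^ q) ^ q = γ ^ q := by rw [h]
      apply h1
      rw [← this, ← h3]
      nth_rewrite 2 [← h3]
      rw [h3]
      ring
    intro i j hij
    have p0 : γ ^ q ^ 0 = γ := by simp
    have p1 : γ ^ q ^ 1 = γ ^ q := by simp
    have p2 : γ ^ q ^ 2 = (γ ^ q) ^ q := by ring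
    fin_cases i <;> fin_cases j <;> simp only [Fin.zero_eta, Fin.mk_one, Fin.reduceFinMk] at hij ⊢ <;>
      exfalso <;>
      simp only [p0, p1, p2] at hij
    · exact e01 hij.symm
    · exact e02 hij.symm
    · exact e01 hij
    · exact e12 hij.symm
    · exact e02 hij
    · exact e12 hij
  · intro x hx
    have h4 := iterate_mem_of_invariant g hinv (3 * n) hx
    rw [hgn] at h4
    convert h4 using 1
    ext i
    rw [iterate_mul_pow, hE, Pi.mul_apply, hγ, ← pow_mul, ← pow_mul, mul_comm (q ^ (i : ℕ))]
  · intro i hi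
    have h5 := hinv _ hi
    have hs : ∀ i : Fin 3, ∃ c : E, c ≠ 0 ∧ g (Pi.single i 1) = c • Pi.single (i + 1) 1 := by
      intro i
      fin_cases i
      · refine ⟨1, one_ne_zero, ?_⟩
        ext j; fin_cases j <;> simp [hg, cyclicSemilinear]
      · refine ⟨1, one_ne_zero, ?_⟩
        ext j; fin_cases j <;> simp [hg, cyclicSemilinear]
      · refine ⟨a, ha, ?_⟩
        ext j; fin_cases j <;> simp [hg, cyclicSemilinear]
    obtain ⟨c, hc, he⟩ := hs i
    rw [he] at h5
    exact (S.smul_mem_iff hc).1 h5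

/-- The multipliers preserving `S` form a subalgebra containing `γ`. The degree 3 is prime, so `γ`
generates `Z`, and `S` is a nonzero ideal of the field `Z`. -/
theorem eq_top_of_forall_mul_mem {E Z : Type*} [Field E] [Field Z] [Algebra E Z]
    (hZ : Module.finrank E Z = 3) {γ : Z} (hγ : γ ∉ Set.range (algebraMap E Z))
    {S : Submodule E Z} (hS : S ≠ ⊥) (hmul : ∀ x ∈ S, γ * x ∈ S) : S = ⊤ := by
  have : FiniteDimensional E Z := Module.finite_of_finrank_pos (by omega)
  let A : Subalgebra E Z :=
    { carrier := {z | ∀ x ∈ S, z * x ∈ S}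
      mul_mem' := fun {a b} ha hb x hx => by rw [mul_assoc]; exact ha _ (hb _ hx)
      add_mem' := fun {a b} ha hb x hx => by rw [add_mul]; exact S.add_mem (ha _ hx) (hb _ hx)
      algebraMap_mem' := fun r x hx => by rw [← Algebra.smul_def]; exact S.smul_mem _ hx }
  have hA : A = ⊤ := by
    have hfr : Module.finrank E (IntermediateField.adjoin E {γ}) = 3 := by
      have hd := Module.finrank_mul_finrank E (IntermediateField.adjoin E {γ}) Z
      rw [hZ] at hd
      rcases (Nat.dvd_prime Nat.prime_three).1 ⟨_, hd.symm⟩ with h | h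
      · exact absurd (IntermediateField.mem_bot.1
          (IntermediateField.finrank_adjoin_simple_eq_one_iff.1 h)) hγ
      · exact h
    have htop : IntermediateField.adjoin E {γ} = ⊤ := by
      apply IntermediateField.eq_of_le_of_finrank_eq le_top
      rw [hfr, IntermediateField.finrank_top', hZ]
    have h2 : Algebra.adjoin E {γ} = ⊤ := by
      rw [← IntermediateField.adjoin_simple_toSubalgebra_of_isAlgebraic
        (Algebra.IsAlgebraic.isAlgebraic γ), htop, IntermediateField.top_toSubalgebra]
    rw [eq_top_iff, ← h2]
    exact Algebra.adjoin_le (by simpa [A] using! hmul)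
  obtain ⟨x, hx, hx0⟩ := S.ne_bot_iff.1 hS
  rw [eq_top_iff]
  intro z _
  have hz : z / x ∈ A := hA ▸ Algebra.mem_top
  have := hz x hx
  rwa [div_mul_cancel₀ _ hx0] at this

theorem exists_irreducibleSemilinear_of_dvd {F E : Type*} [Field F] [Finite F] [Field E]
    [Algebra F E] [Finite E] (h3 : 3 ∣ Module.finrank F E) :
    ∃ (σ : E →ₐ[F] E) (g : (Fin 3 → E) →ₛₗ[(σ : E →+* E)] (Fin 3 → E)),
      (∀ x, σ x = x ↔ x ∈ Set.range (algebraMap F E)) ∧ IsIrreducibleSemilinear g := by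
  have := Fintype.ofFinite F
  have := Fintype.ofFinite E
  obtain ⟨n, hn⟩ := h3
  have ht : 0 < Module.finrank F E := Module.finrank_pos
  have hcard : Nat.card E = (Nat.card F ^ 3) ^ n := by
    rw [← pow_mul, ← hn, ← Module.natCard_eq_pow_finrank]
  obtain ⟨c, hc, h3, h1⟩ := exists_norm_power_not_fixed (q := Nat.card F) Finite.one_lt_card
    (by rintro rfl; omega) hcard
  have hσ : ∀ x, FiniteField.frobeniusAlgHom F E x = x ^ Nat.card F := fun x => by
    simp
  refine ⟨FiniteField.frobeniusAlgHom F E, cyclicSemilinear _ c, fun x => ?_,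
    isIrreducibleSemilinear_cyclicSemilinear _ hσ (fun x => ?_) hc h3 h1⟩
  · rw [mem_range_algebraMap_iff_pow_card, hσ]
  · rw [← hcard, Nat.card_eq_fintype_card, FiniteField.pow_card]

/-- Identify `E³` with the cubic extension `Z` of `E` and take `g x = c x^(q^3)`. With `t = [E :
F]`, `g^t` is multiplication by the norm power `γ` of `c`. As 3 and `t` are coprime, `x ↦ x^(q^3)`
fixes only `F` in `E`, and `γ ∈ E` would force `γ^q = γ`. -/
theorem exists_irreducibleSemilinear_of_not_dvd {F E : Type*} [Field F] [Finite F] [Field E]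
    [Algebra F E] [Finite E] (h3 : ¬ 3 ∣ Module.finrank F E) :
    ∃ (σ : E →ₐ[F] E) (g : (Fin 3 → E) →ₛₗ[(σ : E →+* E)] (Fin 3 → E)),
      (∀ x, σ x = x ↔ x ∈ Set.range (algebraMap F E)) ∧ IsIrreducibleSemilinear g := by
  have := Fintype.ofFinite F
  have := Fintype.ofFinite E
  have hcop : Nat.Coprime 3 (Module.finrank F E) := (Nat.prime_three.coprime_iff_not_dvd).2 h3
  have ht : 0 < Module.finrank F E := Module.finrank_pos
  obtain ⟨p, hp⟩ := CharP.exists E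
  have : Fact p.Prime := ⟨CharP.char_is_prime E p⟩
  let Z := FiniteField.Extension E p 3
  have hZ : Module.finrank E Z = 3 := FiniteField.finrank_extension E p 3
  have : Finite Z := Module.finite_of_finite E
  have := Fintype.ofFinite Z
  let _ : Algebra F Z := ((algebraMap E Z).comp (algebraMap F E)).toAlgebra
  have hcE : Nat.card E = Nat.card F ^ Module.finrank F E := Module.natCard_eq_pow_finrank
  have hcard : Nat.card Z = (Nat.card F ^ 3) ^ Module.finrank F E := by
    rw [pow_right_comm, ← hcE, ← hZ]; exact Module.natCard_eq_pow_finrank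
  obtain ⟨c, hc, hγ3, hγ1⟩ := exists_norm_power_not_fixed (q := Nat.card F) Finite.one_lt_card
    ht.ne' hcard
  set γ := c ^ (∑ j ∈ Finset.range (Module.finrank F E), (Nat.card F ^ 3) ^ j) with hγ
  let σ := FiniteField.frobeniusAlgHom F E ^ 3
  have hσ : ∀ x, σ x = x ^ Nat.card F ^ 3 := frobeniusAlgHom_pow_apply 3
  have hs : ∀ x, (FiniteField.frobeniusAlgHom F Z ^ 3) x = x ^ Nat.card F ^ 3 :=
    frobeniusAlgHom_pow_apply 3
  let g : Z →ₛₗ[(σ : E →+* E)] Z :=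
    { toFun := fun x => c * (FiniteField.frobeniusAlgHom F Z ^ 3) x
      map_add' := fun x y => by rw [map_add, mul_add]
      map_smul' := fun e x => by
        rw [hs, hs, Algebra.smul_def, Algebra.smul_def, mul_pow]
        simp only [RingHom.coe_coe, hσ, map_pow]
        ring }
  have hgx : ∀ x, g x = c * x ^ Nat.card F ^ 3 := fun x => by rw [← hs]; rfl
  have hg : IsIrreducibleSemilinear g := by
    intro S hS hinv
    refine eq_top_of_forall_mul_mem hZ (γ := γ) ?_ hS ?_
    · rw [mem_range_algebraMap_iff_pow_card, hcE]
      exact fun h => hγ1 (pow_card_eq_of_coprime_periods hcop hγ3 h)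
    · intro x hx
      have h4 := iterate_mem_of_invariant g hinv (Module.finrank F E) hx
      rwa [show (g : Z → Z) = fun x => c * x ^ Nat.card F ^ 3 from funext hgx, iterate_mul_pow,
        ← hcard, Nat.card_eq_fintype_card (α := Z), FiniteField.pow_card] at h4
  let φ : Z ≃ₗ[E] (Fin 3 → E) := LinearEquiv.ofFinrankEq _ _ (by rw [hZ]; simp)
  refine ⟨σ, φ.toLinearMap.comp (g.comp φ.symm.toLinearMap), fun x => ?_, ?_⟩
  · rw [mem_range_algebraMap_iff_pow_card, hσ]
    refine ⟨fun h => pow_card_eq_of_coprime_periods hcop h ?_, fun h => ?_⟩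
    · rw [← hcE, Nat.card_eq_fintype_card, FiniteField.pow_card]
    · have h5 := Function.iterate_fixed (f := fun y : E => y ^ Nat.card F) h 3
      rwa [pow_iterate] at h5
  · intro S hS hinv
    have h5 := hg (S.comap φ.toLinearMap) ?_ ?_
    · rw [eq_top_iff]
      intro x _
      have : φ.symm x ∈ S.comap φ.toLinearMap := h5 ▸ Submodule.mem_top
      simpa using this
    · obtain ⟨x, hx, hx0⟩ := S.ne_bot_iff.1 hS
      exact (Submodule.ne_bot_iff _).2 ⟨φ.symm x, by simpa using hx, by simpa using hx0⟩
    · intro x hx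
      simpa using hinv _ hx

theorem exists_irreducibleSemilinear (F E : Type*) [Field F] [Finite F] [Field E]
    [Algebra F E] [Finite E] :
    ∃ (σ : E →ₐ[F] E) (g : (Fin 3 → E) →ₛₗ[(σ : E →+* E)] (Fin 3 → E)),
      (∀ x, σ x = x ↔ x ∈ Set.range (algebraMap F E)) ∧ IsIrreducibleSemilinear g := by
  by_cases h3 : 3 ∣ Module.finrank F E
  · exact exists_irreducibleSemilinear_of_dvd h3
  · exact exists_irreducibleSemilinear_of_not_dvd h3

/-! ### Vector criteria for scattered sets and clubs -/

section Criterion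

variable {F L V : Type*} [Field F] [Field L] [Algebra F L]
  [AddCommGroup V] [Module F V] [Module L V] [IsScalarTower F L V]

theorem linearSetWeight_eq_one_iff {U : Submodule F V} {u : V} (hu : u ∈ U) (hu0 : u ≠ 0) :
    linearSetWeight U (Submodule.span L {u}) = 1 ↔
      ∀ c : L, c • u ∈ U → c ∈ Set.range (algebraMap F L) := by
  have hmem : u ∈ U ⊓ (Submodule.span L {u}).restrictScalars F :=
    ⟨hu, Submodule.mem_span_singleton_self u⟩
  have hne : (⟨u, hmem⟩ : ↥(U ⊓ (Submodule.span L {u}).restrictScalars F)) ≠ 0 := by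
    simpa [Subtype.ext_iff] using hu0
  rw [linearSetWeight, finrank_eq_one_iff_of_nonzero' _ hne]
  constructor
  · intro h c hc
    obtain ⟨a, ha⟩ := h ⟨c • u, hc, Submodule.smul_mem _ _ (Submodule.mem_span_singleton_self u)⟩
    refine ⟨a, ?_⟩
    have ha' : a • u = c • u := congrArg Subtype.val ha
    rw [← algebraMap_smul L a u] at ha'
    exact smul_left_injective L hu0 ha'
  · rintro h ⟨w, hwU, hw⟩
    obtain ⟨c, rfl⟩ := Submodule.mem_span_singleton.1 hw
    obtain ⟨a, rfl⟩ := h c hwU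
    exact ⟨a, Subtype.ext (algebraMap_smul L a u).symm⟩

theorem isScatteredLinearSet_iff {U : Submodule F V} :
    IsScatteredLinearSet L U ↔
      ∀ u ∈ U, u ≠ 0 → ∀ c : L, c • u ∈ U → c ∈ Set.range (algebraMap F L) := by
  constructor
  · intro h u hu hu0
    have := h _ ⟨u, hu0, hu, rfl⟩
    rw [Projectivization.submodule_mk] at this
    exact (linearSetWeight_eq_one_iff hu hu0).1 this
  · rintro h _ ⟨u, hu0, hu, rfl⟩
    rw [Projectivization.submodule_mk]
    exact (linearSetWeight_eq_one_iff hu hu0).2 (h u hu hu0)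

theorem isClubLinearSet_iff {i : ℕ} {U : Submodule F V} :
    IsClubLinearSet L i U ↔ ∃ v ∈ U, v ≠ 0 ∧ linearSetWeight U (Submodule.span L {v}) = i ∧
      ∀ u ∈ U, u ∉ Submodule.span L {v} → ∀ c : L, c • u ∈ U → c ∈ Set.range (algebraMap F L) := by
  constructor
  · rintro ⟨_, ⟨v, hv0, hv, rfl⟩, hw, h⟩
    rw [Projectivization.submodule_mk] at hw
    refine ⟨v, hv, hv0, hw, fun u hu huv => ?_⟩
    have hu0 : u ≠ 0 := by rintro rfl; exact huv (Submodule.zero_mem _)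
    have := h _ ⟨u, hu0, hu, rfl⟩ (fun he => huv (by
      rw [← Projectivization.submodule_mk v hv0, ← he, Projectivization.submodule_mk]
      exact Submodule.mem_span_singleton_self u))
    rw [Projectivization.submodule_mk] at this
    exact (linearSetWeight_eq_one_iff hu hu0).1 this
  · rintro ⟨v, hv, hv0, hw, h⟩
    refine ⟨_, ⟨v, hv0, hv, rfl⟩, by rwa [Projectivization.submodule_mk], ?_⟩
    rintro _ ⟨u, hu0, hu, rfl⟩ hne
    rw [Projectivization.submodule_mk]
    refine (linearSetWeight_eq_one_iff hu hu0).2 (h u hu fun huv => hne ?_)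
    obtain ⟨c, hc⟩ := Submodule.mem_span_singleton.1 huv
    exact (Projectivization.mk_eq_mk_iff' L u v hu0 hv0).2 ⟨c, hc⟩

end Criterion

/-! ### Existence of maximum scattered linear sets -/

/-- `V` has a scattered `F`-linear set of the maximum rank `dim_L V * [L : F] / 2`. -/
def HasMaximumScattered (F L V : Type*) [Field F] [Field L] [Algebra F L]
    [AddCommGroup V] [Module F V] [Module L V] [IsScalarTower F L V] : Prop :=
  ∃ U : Submodule F V, IsScatteredLinearSet L U ∧
    2 * Module.finrank F U = Module.finrank L V * Module.finrank F L

section Existence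

variable {F L V W : Type*} [Field F] [Field L] [Algebra F L]
  [AddCommGroup V] [Module F V] [Module L V] [IsScalarTower F L V]
  [AddCommGroup W] [Module F W] [Module L W] [IsScalarTower F L W]

theorem IsScatteredLinearSet.map {U : Submodule F V} (hU : IsScatteredLinearSet L U)
    (f : V →ₗ[L] W) (hf : Function.Injective f) :
    IsScatteredLinearSet L (U.map (f.restrictScalars F)) := by
  rw [isScatteredLinearSet_iff] at hU ⊢
  rintro _ ⟨u, hu, rfl⟩ h0 c ⟨w, hw, he⟩
  refine hU u hu (by rintro rfl; simp at h0) c ?_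
  have : f w = f (c • u) := by rw [map_smul]; exact he
  rwa [← hf this]

theorem HasMaximumScattered.of_linearEquiv (h : HasMaximumScattered F L V) (e : V ≃ₗ[L] W) :
    HasMaximumScattered F L W := by
  obtain ⟨U, hU, hr⟩ := h
  refine ⟨_, hU.map e.toLinearMap e.injective, ?_⟩
  rw [← (Submodule.equivMapOfInjective (e.toLinearMap.restrictScalars F) e.injective U).finrank_eq,
    hr, e.finrank_eq]

theorem HasMaximumScattered.prod [FiniteDimensional F L] [FiniteDimensional L V]
    [FiniteDimensional L W] (hV : HasMaximumScattered F L V) (hW : HasMaximumScattered F L W) :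
    HasMaximumScattered F L (V × W) := by
  have : FiniteDimensional F V := Module.Finite.trans L V
  have : FiniteDimensional F W := Module.Finite.trans L W
  obtain ⟨U, hU, hr⟩ := hV
  obtain ⟨U', hU', hr'⟩ := hW
  rw [isScatteredLinearSet_iff] at hU hU'
  refine ⟨U.prod U', ?_, ?_⟩
  · rw [isScatteredLinearSet_iff]
    rintro ⟨u, u'⟩ ⟨hu, hu'⟩ h0 c ⟨hc, hc'⟩
    by_cases h : u = 0
    · exact hU' u' hu' (by rintro rfl; exact h0 (by rw [h]; rfl)) c hc'
    · exact hU u hu h c hc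
  · have h : U.prod U' = LinearMap.range (U.subtype.prodMap U'.subtype) := by
      rw [LinearMap.range_prodMap, U.range_subtype, U'.range_subtype]
    rw [h, LinearMap.finrank_range_of_inj, Module.finrank_prod, Module.finrank_prod,
      mul_add, add_mul, hr, hr']
    exact Function.Injective.prodMap U.injective_subtype U'.injective_subtype

end Existence

theorem exists_intermediateField_finrank_eq {F L : Type*} [Field F] [Finite F] [Field L]
    [Algebra F L] [FiniteDimensional F L] {t : ℕ} (ht : t ≠ 0) (hd : t ∣ Module.finrank F L) :
    ∃ E : IntermediateField F L, Module.finrank F E = t := by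
  obtain ⟨p, hp⟩ := CharP.exists F
  have : Fact p.Prime := ⟨CharP.char_is_prime F p⟩
  have : NeZero t := ⟨ht⟩
  have : Finite L := Module.finite_of_finite F
  obtain ⟨f⟩ := FiniteField.nonempty_algHom_of_finrank_dvd (F := F)
    (K := FiniteField.Extension F p t) (L := L) (by rwa [FiniteField.finrank_extension])
  refine ⟨f.fieldRange, ?_⟩
  exact (AlgEquiv.ofInjectiveField f).toLinearEquiv.finrank_eq.symm.trans
    (FiniteField.finrank_extension F p t)

theorem exists_quadratic_generator {E L : Type*} [Field E] [Field L] [Algebra E L]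
    (h : Module.finrank E L = 2) :
    ∃ w : L, (∀ l : L, ∃ A B : E, l = algebraMap E L A + algebraMap E L B * w) ∧
      ∀ A B A' B' : E, algebraMap E L A + algebraMap E L B * w =
        algebraMap E L A' + algebraMap E L B' * w → A = A' ∧ B = B' := by
  have : FiniteDimensional E L := Module.finite_of_finrank_pos (by omega)
  obtain ⟨w, hw⟩ : ∃ w : L, w ∉ Set.range (algebraMap E L) := by
    by_contra! hcon
    have : (⊥ : Subalgebra E L) = ⊤ := by
      rw [eq_top_iff]; intro x _; exact Algebra.mem_bot.2 (hcon x)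
    rw [Subalgebra.bot_eq_top_iff_finrank_eq_one] at this
    omega
  have hli : LinearIndependent E ![(1 : L), w] := by
    rw [LinearIndependent.pair_iff]
    intro s t hst
    by_cases ht : t = 0
    · subst ht
      simpa using hst
    · exfalso
      apply hw
      refine ⟨-s / t, ?_⟩
      rw [Algebra.smul_def, Algebra.smul_def, mul_one] at hst
      have ht' : algebraMap E L t ≠ 0 := by simpa using ht
      rw [map_div₀, map_neg, div_eq_iff ht']
      linear_combination -hst
  refine ⟨w, fun l => ?_, fun A B A' B' hAB => ?_⟩
  · have hsp := hli.span_eq_top_of_card_eq_finrank' (by simp [h])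
    have hl : l ∈ Submodule.span E (Set.range ![(1 : L), w]) := hsp ▸ Submodule.mem_top
    rw [Matrix.range_cons, Matrix.range_cons, Matrix.range_empty, Set.union_empty,
      Set.singleton_union, Submodule.mem_span_pair] at hl
    obtain ⟨A, B, rfl⟩ := hl
    exact ⟨A, B, by simp [Algebra.smul_def]⟩
  · have := LinearIndependent.pair_iff.1 hli (A - A') (B - B') (by
      rw [Algebra.smul_def, Algebra.smul_def, map_sub, map_sub]
      linear_combination hAB)
    exact ⟨sub_eq_zero.1 this.1, sub_eq_zero.1 this.2⟩

/-- Otherwise the span of `x` and `g x` would be a nonzero invariant subspace of dimension at most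
two. -/
theorem IsIrreducibleSemilinear.iterate_notMem_span {E M : Type*} [Field E] [AddCommGroup M]
    [Module E M] {σ : E →+* E} {g : M →ₛₗ[σ] M} (hg : IsIrreducibleSemilinear g)
    (hM : 2 < Module.finrank E M) {x : M} (hx : x ≠ 0) :
    g (g x) ∉ Submodule.span E {x, g x} := by
  classical
  intro h
  have hxS : x ∈ Submodule.span E {x, g x} := Submodule.subset_span (by simp)
  have hgS : g x ∈ Submodule.span E {x, g x} := Submodule.subset_span (by simp)
  have htop : Submodule.span E {x, g x} = ⊤ := by
    refine hg _ ((Submodule.ne_bot_iff _).2 ⟨x, hxS, hx⟩) fun y hy => ?_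
    obtain ⟨a, b, rfl⟩ := Submodule.mem_span_pair.1 hy
    rw [map_add, map_smulₛₗ, map_smulₛₗ]
    exact Submodule.add_mem _ (Submodule.smul_mem _ _ hgS) (Submodule.smul_mem _ _ h)
  have h1 : Module.finrank E (Submodule.span E {x, g x}) ≤ 2 := by
    have := finrank_span_finset_le_card (R := E) ({x, g x} : Finset M)
    rw [Finset.coe_pair] at this
    exact this.trans Finset.card_le_two
  rw [htop, finrank_top] at h1
  omega

/-- For `U = {g x + w x}`, a scalar `A + B w` with `B ≠ 0` mapping a nonzero vector of `U` into `U`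
would put `g (g x)` in the span of `x` and `g x`. If `B = 0`, semilinearity gives `σ A = A`, hence
`A ∈ F`. -/
theorem hasMaximumScattered_three {F L : Type*} [Field F] [Finite F] [Field L] [Algebra F L]
    [FiniteDimensional F L] (h2 : 2 ∣ Module.finrank F L) :
    HasMaximumScattered F L (Fin 3 → L) := by
  obtain ⟨t, ht⟩ := h2
  have hpos : 0 < Module.finrank F L := Module.finrank_pos
  obtain ⟨E, hE⟩ := exists_intermediateField_finrank_eq (F := F) (L := L) (t := t) (by omega)
    ⟨2, by omega⟩
  have : Finite E := Module.finite_of_finite F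
  have hEL : Module.finrank E L = 2 := by
    have := Module.finrank_mul_finrank F E L
    rw [hE, ht, mul_comm 2] at this
    exact Nat.eq_of_mul_eq_mul_left (by omega) this
  obtain ⟨w, hgen, hind⟩ := exists_quadratic_generator hEL
  obtain ⟨σ, g, hσ, hg⟩ := exists_irreducibleSemilinear F E
  obtain ⟨N, T, hw⟩ := hgen (w * w)
  have hgF : ∀ (a : F) (x : Fin 3 → E), g (a • x) = a • g x := fun a x => by
    rw [← algebraMap_smul E a x, map_smulₛₗ]
    simp
  let f : (Fin 3 → E) →ₗ[F] (Fin 3 → L) :=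
    { toFun := fun x i => algebraMap E L (g x i) + algebraMap E L (x i) * w
      map_add' := fun x y => by
        ext i; simp only [map_add, Pi.add_apply]; ring
      map_smul' := fun a x => by
        ext i
        simp only [hgF, Pi.smul_apply]
        simp only [Algebra.smul_def, map_mul, RingHom.id_apply,
          ← IsScalarTower.algebraMap_apply F E L]
        ring }
  have hfx : ∀ x i, f x i = algebraMap E L (g x i) + algebraMap E L (x i) * w := fun _ _ => rfl
  have hf : Function.Injective f := by
    intro x y hxy
    ext i
    have := congrFun hxy i
    rw [hfx, hfx] at this
    exact congrArg _ (hind _ _ _ _ this).2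
  refine ⟨LinearMap.range f, ?_, ?_⟩
  · rw [isScatteredLinearSet_iff]
    rintro _ ⟨x, rfl⟩ h0 c ⟨y, hy⟩
    have hx : x ≠ 0 := by rintro rfl; simp at h0
    have hnot := hg.iterate_notMem_span (by simp) hx
    have hgx : g x ≠ 0 := by
      intro h
      rw [h, map_zero] at hnot
      exact hnot (Submodule.zero_mem _)
    obtain ⟨A, B, rfl⟩ := hgen c
    -- Compare coefficients in the `E`-basis `1, w`, using `w² = N + T w`.
    have hcoord : ∀ i, g y i = A * g x i + B * N * x i ∧
        y i = (A + T * B) * x i + B * g x i := by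
      intro i
      apply hind
      have := congrFun hy i
      rw [Pi.smul_apply, hfx, hfx, smul_eq_mul] at this
      rw [this]
      simp only [map_add, map_mul]
      linear_combination algebraMap E L B * algebraMap E L (x i) * hw
    have hy1 : y = (A + T * B) • x + B • g x := funext fun i => (hcoord i).2
    have hy2 : g y = A • g x + (B * N) • x := funext fun i => (hcoord i).1
    rw [hy1, map_add, map_smulₛₗ, map_smulₛₗ] at hy2
    by_cases hB : B = 0
    · subst hB
      simp only [mul_zero, add_zero, map_zero, zero_smul, zero_mul] at hy2
      have hA : σ A = A := smul_left_injective E hgx hy2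
      obtain ⟨a, ha⟩ := (hσ A).1 hA
      exact ⟨a, by simp [← ha]⟩
    · exfalso
      apply hnot
      have hσB : σ B ≠ 0 := by simpa using hB
      refine ((Submodule.span E {x, g x}).smul_mem_iff hσB).1 ?_
      -- The coefficients come from equating the two expressions for `g y` and solving for `σ B • g
      -- (g x)`.
      refine Submodule.mem_span_pair.2 ⟨B * N, A - σ (A + T * B), ?_⟩
      rw [sub_smul]
      simp only [RingHom.coe_coe] at hy2
      linear_combination (exp := 1) -hy2
  · rw [LinearMap.finrank_range_of_inj hf, Module.finrank_pi_fintype, Module.finrank_pi_fintype]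
    simp [hE, ht]
    ring

/-- On the graph of Frobenius, `(c x)^q = c x^q` with `x ≠ 0` gives `c^q = c`. -/
theorem hasMaximumScattered_two (F L : Type*) [Field F] [Finite F] [Field L] [Algebra F L]
    [FiniteDimensional F L] : HasMaximumScattered F L (L × L) := by
  have := Fintype.ofFinite F
  have : Finite L := Module.finite_of_finite F
  let f : L →ₗ[F] L × L := LinearMap.id.prod (FiniteField.frobeniusAlgHom F L).toLinearMap
  have hf : Function.Injective f := fun x y h => (Prod.ext_iff.1 h).1
  refine ⟨LinearMap.range f, ?_, ?_⟩
  · rw [isScatteredLinearSet_iff]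
    rintro _ ⟨x, rfl⟩ h0 c ⟨y, hy⟩
    have hx : x ≠ 0 := by rintro rfl; simp at h0
    rw [mem_range_algebraMap_iff_pow_card, Nat.card_eq_fintype_card]
    have h1 : y = c * x := (Prod.ext_iff.1 hy).1
    have h2 : y ^ Fintype.card F = c * x ^ Fintype.card F := (Prod.ext_iff.1 hy).2
    rw [h1, mul_pow] at h2
    exact mul_right_cancel₀ (pow_ne_zero _ hx) h2
  · rw [LinearMap.finrank_range_of_inj hf, Module.finrank_prod, Module.finrank_self]

theorem hasMaximumScattered_pi {F L : Type*} [Field F] [Finite F] [Field L] [Algebra F L]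
    [FiniteDimensional F L] : ∀ r : ℕ, r ≠ 1 → 2 ∣ r * Module.finrank F L →
      HasMaximumScattered F L (Fin r → L)
  | 0, _, _ => ⟨⊥, isScatteredLinearSet_iff.2 fun u hu h0 => absurd ((Submodule.mem_bot F).1 hu) h0,
      by simp⟩
  | 1, h, _ => absurd rfl h
  | 3, _, h => hasMaximumScattered_three ((Nat.prime_two.dvd_mul.1 h).resolve_left (by decide))
  | 2, _, _ => (hasMaximumScattered_two F L).of_linearEquiv
      (LinearEquiv.ofFinrankEq _ _ (by simp))
  -- Splitting off two dimensions preserves the parity condition and, starting from `r + 4`, never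
  -- reaches the excluded dimension one.
  | r + 4, _, h => by
    have h' : 2 ∣ (r + 2) * Module.finrank F L := by
      have : (r + 4) * Module.finrank F L = (r + 2) * Module.finrank F L +
        2 * Module.finrank F L := by ring
      rw [this] at h
      exact (Nat.dvd_add_left (Dvd.intro _ rfl)).1 h
    exact ((hasMaximumScattered_pi (r + 2) (by omega) h').prod
      (hasMaximumScattered_two F L)).of_linearEquiv (LinearEquiv.ofFinrankEq _ _ (by simp))

theorem hasMaximumScattered {F L V : Type*} [Field F] [Finite F] [Field L] [Algebra F L]
    [AddCommGroup V] [Module F V] [Module L V] [IsScalarTower F L V] [FiniteDimensional F L]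
    [FiniteDimensional L V] (h1 : Module.finrank L V ≠ 1)
    (h2 : 2 ∣ Module.finrank L V * Module.finrank F L) : HasMaximumScattered F L V :=
  (hasMaximumScattered_pi _ h1 h2).of_linearEquiv (LinearEquiv.ofFinrankEq _ _ (by simp))

/-! ### Cones and the club of weight `m/2` on a line -/

section Cone

variable {F L V : Type*} [Field F] [Field L] [Algebra F L]
  [AddCommGroup V] [Module F V] [Module L V] [IsScalarTower F L V]

theorem isClubLinearSet_sup_of_isScatteredLinearSet {W : Submodule L V} {U' U'' : Submodule F V}
    {x : V} {i : ℕ} (hi : i ≠ 0) (hxW : Submodule.span L {x} ⊓ W = ⊥)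
    (hU' : U' ≤ W.restrictScalars F) (hs : IsScatteredLinearSet L U')
    (hU'' : U'' ≤ (Submodule.span L {x}).restrictScalars F) (hr : Module.finrank F U'' = i) :
    IsClubLinearSet L i (U' ⊔ U'') := by
  have hne : U'' ≠ ⊥ := by
    rintro rfl
    exact hi (by rw [← hr, finrank_bot])
  obtain ⟨v, hv, hv0⟩ := U''.ne_bot_iff.1 hne
  have hzero : ∀ y ∈ Submodule.span L {x}, y ∈ W → y = 0 := fun y hy hyW => by
    have : y ∈ Submodule.span L {x} ⊓ W := ⟨hy, hyW⟩
    rwa [hxW, Submodule.mem_bot] at this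
  have hspan : Submodule.span L {v} = Submodule.span L {x} := by
    obtain ⟨c, rfl⟩ := Submodule.mem_span_singleton.1 (hU'' hv)
    exact Submodule.span_singleton_smul_eq (IsUnit.mk0 c (by rintro rfl; simp at hv0)) x
  rw [isClubLinearSet_iff]
  refine ⟨v, Submodule.mem_sup_right hv, hv0, ?_, ?_⟩
  · have h : (U' ⊔ U'') ⊓ (Submodule.span L {x}).restrictScalars F = U'' := by
      refine le_antisymm ?_ (le_inf le_sup_right hU'')
      rintro _ ⟨hu, hux⟩
      obtain ⟨a, ha, b, hb, rfl⟩ := Submodule.mem_sup.1 hu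
      have : a = 0 := by
        refine hzero a ?_ (hU' ha)
        have := (Submodule.span L {x}).sub_mem hux (hU'' hb)
        rwa [add_sub_cancel_right] at this
      rwa [this, zero_add]
    rw [linearSetWeight, hspan, h, hr]
  · intro u hu hux c hcu
    rw [hspan] at hux
    obtain ⟨a, ha, b, hb, rfl⟩ := Submodule.mem_sup.1 hu
    obtain ⟨a', ha', b', hb', he⟩ := Submodule.mem_sup.1 hcu
    have ha0 : a ≠ 0 := by
      rintro rfl
      rw [zero_add] at hux
      exact hux (hU'' hb)
    -- The left side lies in `W` and the right side in `⟨x⟩`, so both vanish.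
    have hd : c • a - a' = b' - c • b := by
      rw [smul_add] at he
      rw [sub_eq_sub_iff_add_eq_add, ← he, add_comm]
    have h0 : c • a - a' = 0 := by
      refine hzero _ ?_ (W.sub_mem (W.smul_mem _ (hU' ha)) (hU' ha'))
      rw [hd]
      exact Submodule.sub_mem _ (hU'' hb') (Submodule.smul_mem _ _ (hU'' hb))
    exact isScatteredLinearSet_iff.1 hs a ha ha0 c (by rwa [sub_eq_zero.1 h0])

theorem finrank_sup_of_span_inf_eq_bot [FiniteDimensional F V] {W : Submodule L V}
    {U' U'' : Submodule F V} {x : V} (hxW : Submodule.span L {x} ⊓ W = ⊥)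
    (hU' : U' ≤ W.restrictScalars F) (hU'' : U'' ≤ (Submodule.span L {x}).restrictScalars F) :
    Module.finrank F (U' ⊔ U'' : Submodule F V) = Module.finrank F U' + Module.finrank F U'' := by
  have h : U' ⊓ U'' = ⊥ := by
    rw [eq_bot_iff]
    rintro y ⟨hy', hy''⟩
    have : y ∈ Submodule.span L {x} ⊓ W := ⟨hU'' hy'', hU' hy'⟩
    rwa [hxW] at this
  rw [← Submodule.finrank_sup_add_finrank_inf_eq, h, finrank_bot, add_zero]

theorem finrank_restrictScalars_span_singleton {x : V} (hx : x ≠ 0) :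
    Module.finrank F ((Submodule.span L {x}).restrictScalars F) = Module.finrank F L :=
  ((LinearEquiv.toSpanNonzeroSingleton L V x hx).restrictScalars F).finrank_eq.symm

theorem exists_le_span_singleton_finrank_eq [FiniteDimensional F L] {x : V} (hx : x ≠ 0) {i : ℕ}
    (hi : i ≤ Module.finrank F L) :
    ∃ U : Submodule F V, U ≤ (Submodule.span L {x}).restrictScalars F ∧ Module.finrank F U = i := by
  let f : L →ₗ[F] V := (LinearMap.toSpanSingleton L V x).restrictScalars F
  have hf : Function.Injective f := smul_left_injective L hx
  obtain ⟨b, hb⟩ := exists_linearIndependent_of_le_finrank hi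
  refine ⟨(Submodule.span F (Set.range b)).map f, ?_, ?_⟩
  · rintro _ ⟨c, -, rfl⟩
    exact Submodule.smul_mem _ _ (Submodule.mem_span_singleton_self x)
  · rw [← (Submodule.equivMapOfInjective f hf _).finrank_eq, finrank_span_eq_card hb,
      Fintype.card_fin]

theorem exists_hyperplane {k : ℕ} (hk : 1 ≤ k) (hV : Module.finrank L V = k) :
    ∃ (W : Submodule L V) (x : V), x ≠ 0 ∧ Submodule.span L {x} ⊓ W = ⊥ ∧
      Module.finrank L W + 1 = k := by
  have : FiniteDimensional L V := Module.finite_of_finrank_pos (by omega)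
  have : Nontrivial V := Module.nontrivial_of_finrank_pos (R := L) (by omega)
  obtain ⟨x, hx⟩ := exists_ne (0 : V)
  obtain ⟨W, hW⟩ := (Submodule.span L {x}).exists_isCompl
  refine ⟨W, x, hx, hW.inf_eq_bot, ?_⟩
  have := Submodule.finrank_add_eq_of_isCompl hW
  rw [finrank_span_singleton hx] at this
  omega

/-- Here the club is `{(a + b w, b^q) : a, b ∈ E}` with `[L : E] = 2`; the vectors with `b = 0` form
the heavy point. For `b ≠ 0`, a multiplier `c` lies in `E` by the second coordinate. The coefficient
of `w` then gives `b' = c b`, and the second coordinate yields `c^q = c`. -/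
theorem exists_isClubLinearSet_of_finrank_eq_two [Finite F] [FiniteDimensional F L]
    (hV : Module.finrank L V = 2) {i : ℕ} (hi : 2 * i = Module.finrank F L) :
    ∃ U : Submodule F V, IsClubLinearSet L i U ∧ Module.finrank F U = 2 * i := by
  have hpos : 0 < Module.finrank F L := Module.finrank_pos
  have : FiniteDimensional L V := Module.finite_of_finrank_pos (by omega)
  have := Fintype.ofFinite F
  obtain ⟨E, hE⟩ := exists_intermediateField_finrank_eq (F := F) (L := L) (t := i) (by omega)
    ⟨2, by omega⟩
  have : Finite E := Module.finite_of_finite F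
  have hEL : Module.finrank E L = 2 := by
    have := Module.finrank_mul_finrank F E L
    rw [hE, ← hi, mul_comm 2] at this
    exact Nat.eq_of_mul_eq_mul_left (by omega) this
  obtain ⟨w, hgen, hind⟩ := exists_quadratic_generator hEL
  let σ := FiniteField.frobeniusAlgHom F E
  have hσ : ∀ x : E, σ x = x → x ∈ Set.range (algebraMap F E) := fun x hx => by
    rw [mem_range_algebraMap_iff_pow_card, Nat.card_eq_fintype_card]
    exact hx
  let φ : (L × L) ≃ₗ[L] V := LinearEquiv.ofFinrankEq _ _ (by simp [hV])
  let ι : E →ₗ[F] L := E.val.toLinearMap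
  let f : (E × E) →ₗ[F] V := (φ.toLinearMap.restrictScalars F).comp
    ((ι.coprod ((LinearMap.mulRight F w).comp ι)).prod
      (ι.comp (σ.toLinearMap.comp (LinearMap.snd F E E))))
  have hf : ∀ p : E × E, f p =
      φ (algebraMap E L p.1 + algebraMap E L p.2 * w, algebraMap E L (σ p.2)) := fun _ => rfl
  have hinj : Function.Injective f := by
    intro p p' h
    rw [hf, hf] at h
    have := hind _ _ _ _ (Prod.ext_iff.1 (φ.injective h)).1
    exact Prod.ext this.1 this.2
  have hspan : ∀ p : E × E, f p ∈ Submodule.span L {φ ((1, 0) : L × L)} ↔ p.2 = 0 := by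
    intro p
    rw [Submodule.mem_span_singleton]
    constructor
    · rintro ⟨c, hc⟩
      rw [hf, ← map_smul] at hc
      have h2 : c * 0 = algebraMap E L (σ p.2) := (Prod.ext_iff.1 (φ.injective hc)).2
      rw [mul_zero, eq_comm] at h2
      simpa using h2
    · intro h
      refine ⟨algebraMap E L p.1, ?_⟩
      rw [hf, h, ← map_smul]
      simp
  refine ⟨LinearMap.range f, isClubLinearSet_iff.2 ⟨φ (1, 0), ⟨(1, 0), ?_⟩, ?_, ?_, ?_⟩, ?_⟩
  · rw [hf]; simp
  · simp
  · have h : LinearMap.range f ⊓ (Submodule.span L {φ ((1, 0) : L × L)}).restrictScalars F =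
        LinearMap.range (f.comp (LinearMap.inl F E E)) := by
      ext y
      constructor
      · rintro ⟨⟨p, rfl⟩, hp⟩
        exact ⟨p.1, congrArg f (Prod.ext rfl ((hspan p).1 hp).symm)⟩
      · rintro ⟨a, rfl⟩
        exact ⟨⟨_, rfl⟩, (hspan _).2 rfl⟩
    rw [linearSetWeight, h, LinearMap.finrank_range_of_inj, hE]
    exact hinj.comp LinearMap.inl_injective
  · rintro _ ⟨p, rfl⟩ hp c ⟨p', hp'⟩
    rw [hspan] at hp
    rw [hf, hf, ← map_smul] at hp'
    have h := Prod.ext_iff.1 (φ.injective hp')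
    have h1 : algebraMap E L p'.1 + algebraMap E L p'.2 * w =
      c * (algebraMap E L p.1 + algebraMap E L p.2 * w) := h.1
    have h2 : algebraMap E L (σ p'.2) = c * algebraMap E L (σ p.2) := h.2
    have hσp : σ p.2 ≠ 0 := by simpa using hp
    have hσp' : algebraMap E L (σ p.2) ≠ 0 := by simpa using hp
    obtain ⟨e, rfl⟩ : ∃ e : E, algebraMap E L e = c :=
      ⟨σ p'.2 / σ p.2, by rw [map_div₀, h2, mul_div_cancel_right₀ _ hσp']⟩
    have h3 : p'.2 = e * p.2 := by
      refine (hind p'.1 p'.2 (e * p.1) (e * p.2) ?_).2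
      rw [h1, map_mul, map_mul]; ring
    rw [← map_mul] at h2
    have h4 : σ p'.2 = e * σ p.2 := (algebraMap E L).injective h2
    rw [h3, map_mul] at h4
    obtain ⟨a, rfl⟩ := hσ e (mul_right_cancel₀ hσp h4)
    exact ⟨a, IsScalarTower.algebraMap_apply F E L a⟩
  · rw [LinearMap.finrank_range_of_inj hinj, Module.finrank_prod, hE, two_mul]

end Cone

/-! ### The upper bounds on the rank -/

theorem natCard_ne_zero (M : Type*) [Zero M] [Finite M] :
    Nat.card {x : M // x ≠ 0} = Nat.card M - 1 := by
  classical
  have := Fintype.ofFinite M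
  rw [Nat.card_eq_fintype_card, Nat.card_eq_fintype_card, Fintype.card_subtype_compl]
  simp

/-- For `A ≠ L`, if every `α ≠ 0` failed, some functional `φ ≠ 0` would vanish on `A + αA`. The pair
`(φ, φ ∘ α)` determines `α`, so `q^m - 1 ≤ (q^j - 1)²` with `j = m - dim A`, contradicting `1 ≤ j`
and `2j ≤ m`. -/
theorem exists_sup_map_mulLeft_eq_top {F L : Type*} [Field F] [Finite F] [Field L] [Algebra F L]
    [FiniteDimensional F L] (A : Submodule F L) (hA : Module.finrank F L ≤ 2 * Module.finrank F A)
    (hL : 2 ≤ Module.finrank F L) :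
    ∃ α : L, α ∉ Set.range (algebraMap F L) ∧ A ⊔ A.map (LinearMap.mulLeft F α) = ⊤ := by
  have : Finite L := Module.finite_of_finite F
  by_cases hAt : A = ⊤
  · obtain ⟨α, hα⟩ : ∃ α : L, α ∉ Set.range (algebraMap F L) := by
      by_contra! hcon
      have : (⊥ : Subalgebra F L) = ⊤ := by
        rw [eq_top_iff]; intro x _; exact Algebra.mem_bot.2 (hcon x)
      rw [Subalgebra.bot_eq_top_iff_finrank_eq_one] at this
      omega
    exact ⟨α, hα, by rw [hAt, top_sup_eq]⟩
  · obtain ⟨α, hα0, hα⟩ : ∃ α : L, α ≠ 0 ∧ A ⊔ A.map (LinearMap.mulLeft F α) = ⊤ := by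
      by_contra! hcon
      have hφ : ∀ α : {α : L // α ≠ 0}, ∃ φ : Module.Dual F L, φ ≠ 0 ∧ (∀ x ∈ A, φ x = 0) ∧
          ∀ x ∈ A, φ (α * x) = 0 := by
        rintro ⟨α, hα⟩
        obtain ⟨φ, hφ0, hφ⟩ := Submodule.exists_le_ker_of_lt_top _ (lt_top_iff_ne_top.2 (hcon α hα))
        refine ⟨φ, hφ0, fun x hx => ?_, fun x hx => ?_⟩
        · exact hφ (Submodule.mem_sup_left hx)
        · exact hφ (Submodule.mem_sup_right ⟨x, hx, rfl⟩)
      choose φ hφ0 hφ1 hφ2 using hφ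
      let D := {ψ : A.dualAnnihilator // ψ ≠ 0}
      let g : {α : L // α ≠ 0} → D × D := fun α =>
        (⟨⟨φ α, (Submodule.mem_dualAnnihilator _).2 (hφ1 α)⟩,
          fun h => hφ0 α (congrArg Subtype.val h)⟩,
        ⟨⟨(φ α).comp (LinearMap.mulLeft F α), (Submodule.mem_dualAnnihilator _).2 (hφ2 α)⟩,
          fun h => hφ0 α (by
            ext x
            have := LinearMap.congr_fun (congrArg Subtype.val h) ((α : L)⁻¹ * x)
            simpa [α.2] using this)⟩)
      have hg : Function.Injective g := by
        intro α β h
        have h1 : φ α = φ β := congrArg (fun p : D × D => (p.1 : Module.Dual F L)) h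
        have h2 : (φ α).comp (LinearMap.mulLeft F (α : L)) =
            (φ β).comp (LinearMap.mulLeft F (β : L)) :=
          congrArg (fun p : D × D => (p.2 : Module.Dual F L)) h
        by_contra hne
        have hsub : (α : L) - β ≠ 0 := sub_ne_zero.2 fun h => hne (Subtype.ext h)
        apply hφ0 α
        ext x
        -- Equal pairs make `φ` vanish on `(α - β)L`, which is all of `L` when `α ≠ β`.
        have h3 := LinearMap.congr_fun h2 (((α : L) - β)⁻¹ * x)
        rw [← h1] at h3
        simp only [LinearMap.comp_apply, LinearMap.mulLeft_apply] at h3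
        rw [← sub_eq_zero, ← map_sub, ← sub_mul, mul_inv_cancel_left₀ hsub] at h3
        simpa using h3
      have hDfin : Finite (Module.Dual F L) := Module.finite_of_finite F
      have hle := Nat.card_le_card_of_injective g hg
      have hfr : Module.finrank F A.dualAnnihilator + Module.finrank F A = Module.finrank F L := by
        rw [add_comm]; exact Subspace.finrank_add_finrank_dualAnnihilator_eq A
      rw [Nat.card_prod, natCard_ne_zero L, natCard_ne_zero A.dualAnnihilator,
        Module.natCard_eq_pow_finrank (K := F) (V := L),
        Module.natCard_eq_pow_finrank (K := F) (V := A.dualAnnihilator)] at hle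
      set j := Module.finrank F A.dualAnnihilator with hj
      have hlt : Module.finrank F A < Module.finrank F L := Submodule.finrank_lt hAt
      have hq : 2 ≤ Nat.card F := Finite.one_lt_card
      have hX : 2 ≤ Nat.card F ^ j := hq.trans (Nat.le_self_pow (by omega) _)
      have hpow : Nat.card F ^ j * Nat.card F ^ j ≤ Nat.card F ^ Module.finrank F L := by
        rw [← pow_add]; exact Nat.pow_le_pow_right (by omega) (by omega)
      obtain ⟨X, hX'⟩ : ∃ X, Nat.card F ^ j = X + 2 := ⟨_, (Nat.sub_add_cancel hX).symm⟩
      rw [hX'] at hle hpow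
      have : (X + 2) * (X + 2) ≤ (X + 2 - 1) * (X + 2 - 1) + 1 := by omega
      rw [show X + 2 - 1 = X + 1 by omega] at this
      nlinarith
    refine ⟨α, ?_, hα⟩
    -- A scalar from `F` would give `αA ⊆ A`, hence `A = L`.
    rintro ⟨a, rfl⟩
    apply hAt
    rw [← hα, eq_comm, sup_eq_left]
    rintro _ ⟨x, hx, rfl⟩
    rw [LinearMap.mulLeft_apply, ← Algebra.smul_def]
    exact A.smul_mem _ hx

section Bound

variable {F L V : Type*} [Field F] [Field L] [Algebra F L]
  [AddCommGroup V] [Module F V] [Module L V] [IsScalarTower F L V]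

theorem finrank_comap_toSpanSingleton (U : Submodule F V) {v : V} (hv : v ≠ 0) :
    Module.finrank F (U.comap ((LinearMap.toSpanSingleton L V v).restrictScalars F)) =
      linearSetWeight U (Submodule.span L {v}) := by
  have hf : Function.Injective ((LinearMap.toSpanSingleton L V v).restrictScalars F) :=
    smul_left_injective L hv
  have h : LinearMap.range ((LinearMap.toSpanSingleton L V v).restrictScalars F) =
      (Submodule.span L {v}).restrictScalars F := by
    ext y
    simp [Submodule.mem_span_singleton]
  rw [(Submodule.equivMapOfInjective _ hf _).finrank_eq, linearSetWeight,
    Submodule.map_comap_eq, inf_comm, h]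

/-- The upper bound on the rank of a club of weight at least half the field degree. -/
theorem IsClubLinearSet.two_mul_finrank_le [Finite F] [FiniteDimensional F L]
    [FiniteDimensional L V] {i : ℕ} {U : Submodule F V} (hU : IsClubLinearSet L i U)
    (hi : Module.finrank F L ≤ 2 * i) (hm : 2 ≤ Module.finrank F L) :
    2 * Module.finrank F U + Module.finrank F L ≤
      Module.finrank L V * Module.finrank F L + 2 * i := by
  have : FiniteDimensional F V := Module.Finite.trans L V
  obtain ⟨v, hv, hv0, hw, hclub⟩ := isClubLinearSet_iff.1 hU
  set f : L →ₗ[F] V := (LinearMap.toSpanSingleton L V v).restrictScalars F with hf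
  have hfinj : Function.Injective f := smul_left_injective L hv0
  set A := U.comap f with hAdef
  have hA : Module.finrank F A = i := (finrank_comap_toSpanSingleton U hv0).trans hw
  obtain ⟨α, hα, hsup⟩ := exists_sup_map_mulLeft_eq_top A (by omega) hm
  have hα0 : α ≠ 0 := by rintro rfl; exact hα ⟨0, map_zero _⟩
  set μ : V →ₗ[F] V := (LinearMap.lsmul L V α).restrictScalars F with hμ
  have hμinj : Function.Injective μ := smul_right_injective V hα0
  have h1 := Submodule.finrank_sup_add_finrank_inf_eq U (U.map μ)
  rw [← (Submodule.equivMapOfInjective μ hμinj U).finrank_eq] at h1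
  have h2 : Module.finrank F (U ⊔ U.map μ : Submodule F V) ≤
      Module.finrank L V * Module.finrank F L := by
    rw [mul_comm, Module.finrank_mul_finrank]
    exact Submodule.finrank_le _
  have hmul : Function.Injective (LinearMap.mulLeft F α) := mul_right_injective₀ hα0
  have h3 := Submodule.finrank_sup_add_finrank_inf_eq A (A.map (LinearMap.mulLeft F α))
  rw [hsup, finrank_top, ← (Submodule.equivMapOfInjective _ hmul A).finrank_eq, hA] at h3
  -- If `u` and `αu` lie in `U` with `u ∉ ⟨v⟩`, the club property forces `α ∈ F`; only multiples of
  -- `v` remain.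
  have h4 : U ⊓ U.map μ ≤ (A ⊓ A.map (LinearMap.mulLeft F α)).map f := by
    rintro _ ⟨hu, u, hu', rfl⟩
    have huv : u ∈ Submodule.span L {v} := by
      by_contra huv
      exact hα (hclub u hu' huv α hu)
    obtain ⟨c, rfl⟩ := Submodule.mem_span_singleton.1 huv
    have he : μ (c • v) = f (α * c) := smul_smul α c v
    rw [he] at hu ⊢
    exact ⟨α * c, ⟨hu, c, hu', rfl⟩, rfl⟩
  have h5 := Submodule.finrank_mono h4
  rw [← (Submodule.equivMapOfInjective f hfinj _).finrank_eq] at h5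
  omega

/-- A point other than the heavy one meets `U` in dimension 1, and also in dimension at least `dim U
+ m - 2m`. -/
theorem IsClubLinearSet.finrank_le_of_finrank_eq_two [FiniteDimensional F L]
    (hV : Module.finrank L V = 2) {U : Submodule F V}
    (hU : IsClubLinearSet L (Module.finrank F L) U) :
    Module.finrank F U ≤ Module.finrank F L + 1 := by
  have : FiniteDimensional L V := Module.finite_of_finrank_pos (by omega)
  have : FiniteDimensional F V := Module.Finite.trans L V
  obtain ⟨v, hv, hv0, hw, hclub⟩ := isClubLinearSet_iff.1 hU
  by_contra! hlt
  obtain ⟨u, hu, huv⟩ : ∃ u ∈ U, u ∉ Submodule.span L {v} := by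
    by_contra! hcon
    have : U ≤ (Submodule.span L {v}).restrictScalars F := hcon
    have := Submodule.finrank_mono this
    rw [finrank_restrictScalars_span_singleton hv0] at this
    omega
  have hu0 : u ≠ 0 := by rintro rfl; exact huv (Submodule.zero_mem _)
  have h1 := (linearSetWeight_eq_one_iff hu hu0).2 (hclub u hu huv)
  have h2 := Submodule.finrank_sup_add_finrank_inf_eq U ((Submodule.span L {u}).restrictScalars F)
  rw [finrank_restrictScalars_span_singleton hu0] at h2
  rw [linearSetWeight] at h1
  have h3 := Submodule.finrank_le (U ⊔ (Submodule.span L {u}).restrictScalars F)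
  rw [← Module.finrank_mul_finrank F L V, hV] at h3
  omega

/-! ### Clubs attaining the bounds -/

theorem exists_isClubLinearSet_finrank_add_one [FiniteDimensional F L]
    (hV : Module.finrank L V = 2) :
    ∃ U : Submodule F V, IsClubLinearSet L (Module.finrank F L) U ∧
      Module.finrank F U = Module.finrank F L + 1 := by
  have : FiniteDimensional L V := Module.finite_of_finrank_pos (by omega)
  have : FiniteDimensional F V := Module.Finite.trans L V
  obtain ⟨W, x, hx0, hxW, hW⟩ := exists_hyperplane (by omega) hV
  have : Nontrivial W := Module.nontrivial_of_finrank_pos (R := L) (by omega)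
  obtain ⟨⟨y, hyW⟩, hy⟩ := exists_ne (0 : W)
  have hy0 : y ≠ 0 := fun h => hy (Subtype.ext h)
  have hle : Submodule.span F {y} ≤ W.restrictScalars F :=
    (Submodule.span_singleton_le_iff_mem _ _).2 hyW
  refine ⟨Submodule.span F {y} ⊔ (Submodule.span L {x}).restrictScalars F,
    isClubLinearSet_sup_of_isScatteredLinearSet Module.finrank_pos.ne' hxW hle ?_ le_rfl
      (finrank_restrictScalars_span_singleton hx0), ?_⟩
  · rw [isScatteredLinearSet_iff]
    intro u hu hu0 c hc
    obtain ⟨a, rfl⟩ := Submodule.mem_span_singleton.1 hu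
    obtain ⟨b, hb⟩ := Submodule.mem_span_singleton.1 hc
    have ha : algebraMap F L a ≠ 0 := by
      rw [Ne, FaithfulSMul.algebraMap_eq_zero_iff]; rintro rfl; simp at hu0
    rw [← algebraMap_smul L a y, ← algebraMap_smul L b y, smul_smul] at hb
    have := smul_left_injective L hy0 hb
    exact ⟨b / a, by rw [map_div₀, this, mul_div_cancel_right₀ _ ha]⟩
  · rw [finrank_sup_of_span_inf_eq_bot hxW hle le_rfl, finrank_span_singleton hy0,
      finrank_restrictScalars_span_singleton hx0, add_comm]

theorem IsMaximumScatteredIn.isClubLinearSet_sup [FiniteDimensional F V] {k m i : ℕ}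
    (hL : Module.finrank F L = m) {W : Submodule L V} {U' U'' : Submodule F V} {x : V}
    (hi : i ≠ 0) (hW : Module.finrank L W + 1 = k) (hU' : IsMaximumScatteredIn W U')
    (hxW : Submodule.span L {x} ⊓ W = ⊥)
    (hU'' : U'' ≤ (Submodule.span L {x}).restrictScalars F) (hr : Module.finrank F U'' = i) :
    IsClubLinearSet L i (U' ⊔ U'') ∧
      Module.finrank F (U' ⊔ U'' : Submodule F V) = (k - 1) * m / 2 + i := by
  obtain ⟨hle, hs, hrank⟩ := hU'
  refine ⟨isClubLinearSet_sup_of_isScatteredLinearSet hi hxW hle hs hU'' hr, ?_⟩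
  rw [finrank_sup_of_span_inf_eq_bot hxW hle hU'', hr, ← hW, Nat.add_sub_cancel, ← hL, ← hrank]
  omega

theorem exists_isClubLinearSet_finrank_eq [Finite F] [FiniteDimensional F L] {k m i : ℕ}
    (hk : 1 ≤ k) (hL : Module.finrank F L = m) (hV : Module.finrank L V = k)
    (heven : Even ((k - 1) * m)) (hi0 : i ≠ 0) (him : i ≤ m) (h : k ≠ 2 ∨ 2 * i = m) :
    ∃ U : Submodule F V, IsClubLinearSet L i U ∧ Module.finrank F U = (k - 1) * m / 2 + i := by
  have : FiniteDimensional L V := Module.finite_of_finrank_pos (by omega)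
  have : FiniteDimensional F V := Module.Finite.trans L V
  -- For `k = 2` the hyperplane is a single point, the dimension excluded from
  -- `hasMaximumScattered`.
  by_cases hk2 : k = 2
  · obtain ⟨U, hU, hr⟩ := exists_isClubLinearSet_of_finrank_eq_two (F := F) (hV.trans hk2) (i := i)
      (by rw [hL]; exact h.resolve_left (by omega))
    refine ⟨U, hU, ?_⟩
    have := h.resolve_left (by omega)
    rw [hr, hk2, show 2 - 1 = 1 from rfl, one_mul]
    omega
  · obtain ⟨W, x, hx0, hxW, hW⟩ := exists_hyperplane hk hV
    obtain ⟨U₀, hU₀, hr₀⟩ := hasMaximumScattered (F := F) (L := L) (V := W) (by omega) (by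
      rw [hL, show Module.finrank L W = k - 1 by omega]; exact heven.two_dvd)
    obtain ⟨U'', hU'', hr⟩ := exists_le_span_singleton_finrank_eq (F := F) (L := L) hx0
      (i := i) (by omega)
    refine ⟨_, IsMaximumScatteredIn.isClubLinearSet_sup hL hi0 hW
      (U' := U₀.map (W.subtype.restrictScalars F)) ⟨?_, ?_, ?_⟩ hxW hU'' hr⟩
    · rintro _ ⟨y, -, rfl⟩
      exact y.2
    · exact hU₀.map W.subtype W.injective_subtype
    · rw [← (Submodule.equivMapOfInjective (W.subtype.restrictScalars F)
        W.injective_subtype U₀).finrank_eq, hr₀]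

/-- Ranks are bounded by `dim_F V`, and at least one club exists: an `i`-dimensional subspace of one
point, viewed as a cone over the zero subspace. -/
theorem exists_isMaximumRankClub [FiniteDimensional F L] [FiniteDimensional L V] [Nontrivial V]
    {i : ℕ} (hi0 : i ≠ 0) (him : i ≤ Module.finrank F L) :
    ∃ U : Submodule F V, IsMaximumRankClub L i U := by
  have : FiniteDimensional F V := Module.Finite.trans L V
  obtain ⟨x, hx⟩ := exists_ne (0 : V)
  obtain ⟨U'', hU'', hr⟩ := exists_le_span_singleton_finrank_eq (F := F) (L := L) hx him
  have hclub : IsClubLinearSet L i (⊥ ⊔ U'') :=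
    isClubLinearSet_sup_of_isScatteredLinearSet (W := ⊥) hi0 (inf_bot_eq _) bot_le
      (isScatteredLinearSet_iff.2 fun u hu h0 => absurd ((Submodule.mem_bot F).1 hu) h0) hU'' hr
  let s : Set ℕ := {n | ∃ U : Submodule F V, IsClubLinearSet L i U ∧ Module.finrank F U = n}
  have hs : s.Nonempty := ⟨_, _, hclub, rfl⟩
  have hb : BddAbove s := ⟨Module.finrank F V, by
    rintro _ ⟨U, -, rfl⟩; exact Submodule.finrank_le U⟩
  obtain ⟨U, hU, hn⟩ := Nat.sSup_mem hs hb
  exact ⟨U, hU, fun U₁ hU₁ => hn ▸ le_csSup hb ⟨U₁, hU₁, rfl⟩⟩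

end Bound

theorem mainTheorem3 {F L V : Type*} [Field F] [Finite F] [Field L] [Algebra F L]
    [AddCommGroup V] [Module F V] [Module L V] [IsScalarTower F L V]
    (k m : ℕ) (hk : 1 ≤ k) (hm : 1 ≤ m)
    (hL : Module.finrank F L = m) (hV : Module.finrank L V = k)
    (heven : Even ((k - 1) * m)) :
    -- the cone over a maximum scattered linear set in a hyperplane is an `i`-club
    (∀ (i : ℕ) (W : Submodule L V) (U' U'' : Submodule F V) (x : V),
      m ≤ 2 * i →
      Module.finrank L W + 1 = k → IsMaximumScatteredIn W U' →
      x ≠ 0 → Submodule.span L {x} ⊓ W = ⊥ →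
      U'' ≤ (Submodule.span L {x}).restrictScalars F → Module.finrank F U'' = i →
        IsClubLinearSet L i (U' ⊔ U'') ∧
          Module.finrank F (U' ⊔ U'' : Submodule F V) = (k - 1) * m / 2 + i) ∧
    -- `i`-clubs of maximum rank exist, and their rank is the value of the sharp upper bound
    (∀ i : ℕ, m ≤ 2 * i → i ≤ m →
      ∃ U : Submodule F V, IsMaximumRankClub L i U ∧
        (2 ≤ m → (k ≠ 2 ∨ 2 * i = m) → Module.finrank F U = (k - 1) * m / 2 + i) ∧
        (k = 2 → i = m → Module.finrank F U = m + 1)) := by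
  have : FiniteDimensional F L := Module.finite_of_finrank_pos (by omega)
  have : FiniteDimensional L V := Module.finite_of_finrank_pos (by omega)
  have : FiniteDimensional F V := Module.Finite.trans L V
  have : Nontrivial V := Module.nontrivial_of_finrank_pos (R := L) (by omega)
  refine ⟨fun i W U' U'' x hi hW hU' _ hxW hU'' hr =>
    hU'.isClubLinearSet_sup hL (by omega) hW hxW hU'' hr, fun i hi him => ?_⟩
  obtain ⟨U, hU, hmax⟩ := exists_isMaximumRankClub (F := F) (L := L) (V := V) (i := i)
    (by omega) (by omega)
  refine ⟨U, ⟨hU, hmax⟩, fun hm2 h => le_antisymm ?_ ?_, fun hk2 hi_eq => le_antisymm ?_ ?_⟩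
  · have h1 := hU.two_mul_finrank_le (by omega) (by omega)
    rw [hV, hL] at h1
    obtain ⟨j, rfl⟩ : ∃ j, k = j + 1 := ⟨k - 1, by omega⟩
    rw [Nat.add_sub_cancel] at heven ⊢
    -- Evenness of `(k - 1) m` makes the natural-number division by two exact.
    obtain ⟨e, he⟩ := heven
    rw [add_mul, one_mul] at h1
    omega
  · obtain ⟨U₁, hU₁, hr⟩ := exists_isClubLinearSet_finrank_eq (F := F) (L := L) (V := V) hk hL hV
      heven (i := i) (by omega) him h
    rw [← hr]
    exact hmax U₁ hU₁
  · rw [hi_eq, ← hL] at hU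
    rw [← hL]
    exact hU.finrank_le_of_finrank_eq_two (hV.trans hk2)
  · obtain ⟨U₁, hU₁, hr⟩ := exists_isClubLinearSet_finrank_add_one (F := F) (L := L) (V := V)
      (hV.trans hk2)
    rw [hL] at hr hU₁
    rw [← hr]
    exact hmax U₁ (hi_eq ▸ hU₁)
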